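/- Let $X$ be a complex Banach space and let $T$ be a closed (not necessarily densely defined) linear operator in $X$ with domain $D(T)$. Let $\rho(T)$ be the set of $z\in\mathbb{C}$ for which $T-z:D(T)\to X$ is a bijection with bounded inverse, and let $\sigma(T)=\mathbb{C}\setminus\rho(T)$. If $z\in\mathbb{C}$ is not a limit point of $\sigma(T)$, its algebraic multiplicity is the dimension of the range of the Riesz projection $$P_z=-\frac{1}{2\pi i}\oint_{|\zeta-z|=r}(T-\zeta)^{-1}\,d\zeta ,$$ where $r>0$ is such that $\{\zeta : 0<|\zeta-z|\le r\}\subset\rho(T)$ (it does not depend on the choice of $r$). The discrete spectrum $\sigma_{\mathrm{disc}}(T)$ is the set of isolated points of $\sigma(T)$ with finite algebraic multiplicity. The operator $T-z$ is Fredholm if its range is closed and both $\operatorname{nul}(T-z)=\dim\ker(T-z)$ and $\operatorname{def}(T-z)=\dim\big(X/\operatorname{ran}(T-z)\big)$ are finite; its index is then $\operatorname{ind}(T-z)=\operatorname{nul}(T-z)-\operatorname{def}(T-z)$. Let $$\sigma_{\mathrm{ess},5}(T)=\mathbb{C}\setminus\{z : T-z \text{ is Fredholm with } \operatorname{ind}(T-z)=0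 \text{ and a deleted neighborhood of } z \text{ is in } \rho(T)\},$$ $$\sigma_{\mathrm{ess},B}(T)=\mathbb{C}\setminus\{z : \operatorname{ran}(T-z)\text{ is closed, } z \text{ is not a limit point of } \sigma(T) \text{ and is of finite algebraic multiplicity}\}.$$ Then: 1. $\sigma_{\mathrm{disc}}(T)=\{\lambda : \lambda \text{ is an isolated point of } \sigma(T) \text{ such that } T-\lambda \text{ is Fredholm with } \operatorname{ind}(T-\lambda)=0\}$. 2. $\sigma_{\mathrm{ess},5}(T)=\sigma(T)\setminus\sigma_{\mathrm{disc}}(T)$. 3. Browder's essential spectrum agrees with these: $\sigma_{\mathrm{ess},B}(T)=\sigma_{\mathrm{ess},5}(T)$. The same equality holds if in the definition of $\sigma_{\mathrm{ess},B}(T)$ "finite algebraic multiplicity" is read as finite dimension of the generalized null space $\bigcup_{n\ge 1}\ker\big((T-z)^n\big)$. -/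

import Mathlib

open Filter Topology

namespace ClosedOperator

noncomputable section

variable {X : Type*} [NormedAddCommGroup X] [NormedSpace ℂ X]

/-- The operator `T - z` with domain `D(T)`, as a linear map `D(T) → X`. -/
def shift (T : X →ₗ.[ℂ] X) (z : ℂ) : T.domain →ₗ[ℂ] X :=
  T.toFun - z • T.domain.subtype

/-- `R` is a bounded two-sided inverse of `T - z : D(T) → X`. -/
def IsBoundedInverse (T : X →ₗ.[ℂ] X) (z : ℂ) (R : X →L[ℂ] X) : Prop :=
  (∀ x : X, ∃ h : R x ∈ T.domain, shift T z ⟨R x, h⟩ = x) ∧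
    ∀ x : T.domain, R (shift T z x) = x

/-- The resolvent set: all `z` such that `T - z` is boundedly invertible. -/
def rho (T : X →ₗ.[ℂ] X) : Set ℂ :=
  {z | ∃ R : X →L[ℂ] X, IsBoundedInverse T z R}

/-- The spectrum. -/
def sigma (T : X →ₗ.[ℂ] X) : Set ℂ := (rho T)ᶜ

open Classical in
/-- The resolvent `(T - z)⁻¹` for `z` in the resolvent set (and `0` elsewhere). -/
def resolventOp (T : X →ₗ.[ℂ] X) (z : ℂ) : X →L[ℂ] X :=
  if h : ∃ R : X →L[ℂ] X, IsBoundedInverse T z R then h.choose else 0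

/-- The set of isolated points of the spectrum. -/
def isolatedSpectrum (T : X →ₗ.[ℂ] X) : Set ℂ :=
  {z | z ∈ sigma T ∧ ¬ AccPt z (𝓟 (sigma T))}

/-- The Riesz integral `-(2πi)⁻¹ ∮_{|z - c| = r} (T - z)⁻¹ dz`. It is the Riesz projection of `T`
at `c` when the closed disc of radius `r` about `c`, without its centre, lies in the resolvent
set. -/
def rieszProjection (T : X →ₗ.[ℂ] X) (c : ℂ) (r : ℝ) : X →L[ℂ] X :=
  -((2 * Real.pi * Complex.I : ℂ)⁻¹ • ∮ z in C(c, r), resolventOp T z)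

/-- `c` has finite algebraic multiplicity: the range of the Riesz projection at `c` is
finite-dimensional. Here `c` is an isolated point of the spectrum or a point of the resolvent set
(of multiplicity zero); by Cauchy's theorem the admissible radius does not matter. -/
def HasFiniteAlgMult (T : X →ₗ.[ℂ] X) (c : ℂ) : Prop :=
  ∃ r : ℝ, 0 < r ∧ Metric.closedBall c r \ {c} ⊆ rho T ∧
    FiniteDimensional ℂ (LinearMap.range (rieszProjection T c r : X →ₗ[ℂ] X))

/-- The discrete spectrum: isolated points of the spectrum of finite algebraic multiplicity. -/
def sigmaDisc (T : X →ₗ.[ℂ] X) : Set ℂ :=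
  {z | z ∈ isolatedSpectrum T ∧ HasFiniteAlgMult T z}

/-- The range of `T - z`. -/
def ran (T : X →ₗ.[ℂ] X) (z : ℂ) : Submodule ℂ X := LinearMap.range (shift T z)

/-- `T - z` is Fredholm: closed range, finite nullity and finite deficiency. -/
def IsFredholmAt (T : X →ₗ.[ℂ] X) (z : ℂ) : Prop :=
  IsClosed (ran T z : Set X) ∧ FiniteDimensional ℂ (LinearMap.ker (shift T z)) ∧
    FiniteDimensional ℂ (X ⧸ ran T z)

/-- The index `nul (T - z) - def (T - z)`, meaningful when `T - z` is Fredholm. -/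
def indexAt (T : X →ₗ.[ℂ] X) (z : ℂ) : ℤ :=
  (Module.finrank ℂ (LinearMap.ker (shift T z)) : ℤ) - Module.finrank ℂ (X ⧸ ran T z)

/-- All `z` such that `T - z` is Fredholm of index zero and a deleted neighbourhood of `z` is in the
resolvent set. -/
def Delta5 (T : X →ₗ.[ℂ] X) : Set ℂ :=
  {z | IsFredholmAt T z ∧ indexAt T z = 0 ∧ ∀ᶠ w in 𝓝[≠] z, w ∈ rho T}

def sigmaEss5 (T : X →ₗ.[ℂ] X) : Set ℂ := (Delta5 T)ᶜ

/-- All `z` such that `T - z` has closed range, `z` has finite algebraic multiplicity, and `z` is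
not a limit point of the spectrum. -/
def DeltaB (T : X →ₗ.[ℂ] X) : Set ℂ :=
  {z | IsClosed (ran T z : Set X) ∧ HasFiniteAlgMult T z ∧ ¬ AccPt z (𝓟 (sigma T))}

def sigmaEssB (T : X →ₗ.[ℂ] X) : Set ℂ := (DeltaB T)ᶜ

/-- The kernel of `(T - z) ^ n` (with the natural domain of the power). -/
def kerPow (T : X →ₗ.[ℂ] X) (z : ℂ) : ℕ → Submodule ℂ X
  | 0 => ⊥
  | n + 1 => ((kerPow T z n).comap (shift T z)).map T.domain.subtype

/-- The generalized null space, the union of the increasing kernels of the powers of `T - z`. -/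
def genKer (T : X →ₗ.[ℂ] X) (z : ℂ) : Submodule ℂ X := ⨆ n, kerPow T z n

/-- The variant of `DeltaB` in which finite algebraic multiplicity means that the generalized null
space of `T - z` is finite-dimensional. -/
def DeltaB' (T : X →ₗ.[ℂ] X) : Set ℂ :=
  {z | IsClosed (ran T z : Set X) ∧ FiniteDimensional ℂ (genKer T z) ∧
    ¬ AccPt z (𝓟 (sigma T))}

def sigmaEssB' (T : X →ₗ.[ℂ] X) : Set ℂ := (DeltaB' T)ᶜ

end

end ClosedOperator

open Filter Topology

namespace ClosedOperator

/-! ### Perturbation of bounded operators -/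

section BoundedOperators

/-! All the sets involved concern points `z` with a deleted neighborhood in the resolvent set. Take
`w` there and put `R = (T - w)⁻¹`, `S = (T - z) R = 1 - (z - w) R`. This bounded operator has the
range of `T - z` and the same kernels of powers, and `S - ε R` is the same operator for `z + ε`,
hence bijective for small `ε ≠ 0`.

Everything passes through the generalized null space `N` of `S`. If `S` is Fredholm, it maps the
intersection of the ranges of its powers onto itself; being injective nearby, it is injective there,
so the kernels of powers stabilize and `dim N < ∞` (`finiteDimensional_rootSpace`). If `ran S` is
closed and `dim N < ∞`, then `S` is invertible on `X ⧸ N` (`isUnit_quotMap_rootSpace`): so the index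
is that of an endomorphism of `N`, namely zero, and the resolvent extends holomorphically across `z`
modulo `N`, which puts the range of the Riesz projection `P` inside `N`. Conversely `S L = L S = 1 -
P` for some `L`, so finite rank of `P` gives closed range and `N ≤ ran P`. -/

theorem cofg_range_pow {E : Type*} [NormedAddCommGroup E] [NormedSpace ℂ E]
    (S : E →L[ℂ] E) (hS : S.range.CoFG) (n : ℕ) : (S ^ n).range.CoFG := by
  -- A finite-dimensional supplement `G`, not necessarily direct, survives the induction: applying
  -- `S` to `ran (S ^ n) + G = E` yields `ran S`, and a complement of `ran S` supplies the rest.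
  suffices h : ∃ G : Submodule ℂ E, FiniteDimensional ℂ G ∧ (S ^ n).range ⊔ G = ⊤ by
    obtain ⟨G, hG, h⟩ := h
    refine Module.Finite.of_surjective ((S ^ n).range.mkQ.comp G.subtype) ?_
    rw [← LinearMap.range_eq_top, LinearMap.range_comp, Submodule.range_subtype,
      Submodule.map_mkQ_eq_top]
    exact h
  induction n with
  | zero => exact ⟨⊥, inferInstance, by
      rw [pow_zero, sup_bot_eq]; exact LinearMap.range_id⟩
  | succ n ih =>
    obtain ⟨G, hG, h⟩ := ih
    obtain ⟨H, hH⟩ := S.range.exists_isCompl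
    have hHf : FiniteDimensional ℂ H := .of_fg (hS.fg_of_isCompl hH)
    refine ⟨G.map S.toLinearMap ⊔ H, inferInstance, ?_⟩
    have : (S ^ (n + 1)).range = (S ^ n).range.map S.toLinearMap := by
      rw [pow_succ', ← LinearMap.range_comp]; rfl
    rw [this, ← sup_assoc, ← Submodule.map_sup, h, Submodule.map_top, hH.sup_eq_top]

variable {E F : Type*} [NormedAddCommGroup E] [NormedSpace ℂ E] [CompleteSpace E]
  [NormedAddCommGroup F] [NormedSpace ℂ F] [CompleteSpace F]

/-- A bounded operator between Banach spaces whose range has finite codimension has closed range. -/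
theorem isClosed_range_of_cofg (f : E →L[ℂ] F) (hf : f.range.CoFG) :
    IsClosed (f.range : Set F) := by
  obtain ⟨G, hG⟩ := f.range.exists_isCompl
  have hGf : FiniteDimensional ℂ G := .of_fg (hf.fg_of_isCompl hG)
  -- Dividing out the kernel gives the injectivity that the closed-range criterion requires.
  have : IsClosed (f.ker : Set E) := f.isClosed_ker
  have hr : (f.ker.liftQL f le_rfl).range = f.range := by
    rw [Submodule.toLinearMap_liftQL, Submodule.range_liftQ]
  rw [← hr]
  refine ContinuousLinearMap.closed_complemented_range_of_isCompl_of_ker_eq_bot _ G (hr ▸ hG)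
    G.closed_of_finiteDimensional ?_
  rw [Submodule.toLinearMap_liftQL]
  exact Submodule.ker_liftQ_eq_bot _ _ _ le_rfl

/-- A surjective bounded operator with finite-dimensional kernel has a bounded right inverse. -/
theorem exists_rightInverse_of_finiteDimensional_ker (f : E →L[ℂ] F)
    (hf : Function.Surjective f) [FiniteDimensional ℂ f.ker] :
    ∃ g : F →L[ℂ] E, ∀ y, f (g y) = y := by
  obtain ⟨p, hp⟩ := Submodule.ClosedComplemented.of_finiteDimensional f.ker
  have : CompleteSpace f.ker := FiniteDimensional.complete ℂ _
  let e := f.equivProdOfSurjectiveOfIsCompl p (LinearMap.range_eq_top.2 hf)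
    (LinearMap.range_eq_of_proj hp) (LinearMap.isCompl_of_proj hp)
  refine ⟨e.symm ∘L ContinuousLinearMap.inl ℂ F f.ker, fun y => ?_⟩
  exact congrArg Prod.fst (e.apply_symm_apply (y, 0))

/-- If `S` is injective with closed range and arbitrarily small perturbations of `S` along `R` are
onto, then `S` is invertible. -/
theorem isUnit_of_frequently_surjective (S R : E →L[ℂ] E) (hinj : Function.Injective S)
    (hcl : IsClosed (Set.range S))
    (hsurj : ∃ᶠ ε in 𝓝 (0 : ℂ), Function.Surjective ⇑(S - ε • R)) : IsUnit S := by
  obtain ⟨K, hK⟩ := S.antilipschitz_of_injective_of_isClosed_range hinj hcl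
  have hK' : ∀ x, ‖x‖ ≤ K * ‖S x‖ := fun x => by simpa using hK.le_mul_dist x 0
  rw [ContinuousLinearMap.isUnit_iff_bijective]
  refine ⟨hinj, fun y => ?_⟩
  -- Solve `(S - ε R) x = y`. Once `K ‖ε‖ ‖R‖ < 1/2`, the lower bound absorbs the perturbation and
  -- gives `‖x‖ ≤ 2 K ‖y‖`, so `S x - y = ε R x` is as small as desired.
  rw [← Set.mem_range, ← hcl.closure_eq, Metric.mem_closure_iff]
  intro δ hδ
  have h1 : Tendsto (fun ε : ℂ => K * (‖ε‖ * ‖R‖)) (𝓝 0) (𝓝 0) := by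
    have : Continuous fun ε : ℂ => K * (‖ε‖ * ‖R‖) := by fun_prop
    simpa using this.tendsto 0
  have h2 : Tendsto (fun ε : ℂ => ‖ε‖ * ‖R‖ * (2 * K * ‖y‖)) (𝓝 0) (𝓝 0) := by
    have : Continuous fun ε : ℂ => ‖ε‖ * ‖R‖ * (2 * K * ‖y‖) := by fun_prop
    simpa using this.tendsto 0
  obtain ⟨ε, ⟨hε, h1⟩, h2⟩ := ((hsurj.and_eventually
    (h1.eventually_lt_const (by norm_num : (0 : ℝ) < 1 / 2))).and_eventually
    (h2.eventually_lt_const hδ)).exists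
  obtain ⟨x, hx⟩ := hε y
  have hSx : S x = y + ε • R x := by rw [← hx]; simp
  have hR : ‖ε • R x‖ ≤ ‖ε‖ * ‖R‖ * ‖x‖ := by
    rw [norm_smul, mul_assoc]; gcongr; exact R.le_opNorm x
  have hxy : ‖x‖ ≤ 2 * K * ‖y‖ := by
    have h3 : ‖x‖ ≤ K * (‖y‖ + ‖ε‖ * ‖R‖ * ‖x‖) := (hK' x).trans <| by
      rw [hSx]; gcongr; exact (norm_add_le _ _).trans (by gcongr)
    nlinarith [norm_nonneg x]
  refine ⟨S x, ⟨x, rfl⟩, ?_⟩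
  rw [dist_comm, dist_eq_norm, hSx, add_sub_cancel_left]
  refine hR.trans_lt (lt_of_le_of_lt ?_ h2)
  gcongr

/-- If `S` is surjective with finite-dimensional kernel and arbitrarily small perturbations of `S`
along `R` are injective, then `S` is injective. -/
theorem injective_of_frequently_injective (S R : E →L[ℂ] E) (hsurj : Function.Surjective S)
    [FiniteDimensional ℂ S.ker]
    (hinj : ∃ᶠ ε in 𝓝 (0 : ℂ), Function.Injective ⇑(S - ε • R)) : Function.Injective S := by
  obtain ⟨J, hJ⟩ := exists_rightInverse_of_finiteDimensional_ker S hsurj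
  have h1 : Tendsto (fun ε : ℂ => ‖ε • (R * J)‖) (𝓝 0) (𝓝 0) := by
    have : Continuous fun ε : ℂ => ‖ε • (R * J)‖ := by fun_prop
    simpa using this.tendsto 0
  obtain ⟨ε, hε, h1⟩ := (hinj.and_eventually (h1.eventually_lt_const one_pos)).exists
  obtain ⟨u, hu⟩ := isUnit_one_sub_of_norm_lt_one h1
  -- Since `S J = 1`, the product `(S - ε R) J = 1 - ε R J` is invertible. By injectivity of `S - ε
  -- R`, every `x` then lies in `ran J`, on which `S` is injective.
  have hVJ : ∀ y, (S - ε • R) (J y) = u.val y := fun y => by rw [hu]; simp [hJ]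
  have huu : ∀ y, u.val (u⁻¹.val y) = y := fun y => by
    rw [← mul_apply_eq_comp, u.mul_inv]; rfl
  rw [injective_iff_map_eq_zero]
  intro x hx
  have hxJ : x = J (u⁻¹.val ((S - ε • R) x)) := hε (by rw [hVJ, huu])
  have h0 : u⁻¹.val ((S - ε • R) x) = 0 := by rw [← hJ (u⁻¹.val _), ← hxJ, hx]
  rw [hxJ, h0, map_zero]

end BoundedOperators

/-! ### Generalized null space and iterated ranges -/

section RootSpace

variable {E : Type*} [NormedAddCommGroup E] [NormedSpace ℂ E]

/-- The generalized null space `⋃ n, ker (S ^ n)` of a bounded operator. -/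
def rootSpace (S : E →L[ℂ] E) : Submodule ℂ E :=
  Module.End.maxGenEigenspace (S : E →ₗ[ℂ] E) 0

theorem mem_rootSpace {S : E →L[ℂ] E} {x : E} : x ∈ rootSpace S ↔ ∃ n : ℕ, (S ^ n) x = 0 := by
  rw [rootSpace, Module.End.mem_maxGenEigenspace]
  simp only [zero_smul, sub_zero, ← ContinuousLinearMap.toLinearMap_pow]
  rfl

theorem map_mem_rootSpace {S R : E →L[ℂ] E} (h : Commute S R) {x : E} (hx : x ∈ rootSpace S) :
    R x ∈ rootSpace S := by
  obtain ⟨n, hn⟩ := mem_rootSpace.1 hx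
  refine mem_rootSpace.2 ⟨n, ?_⟩
  rw [← mul_apply_eq_comp, (h.pow_left n).eq, mul_apply_eq_comp, hn, map_zero]

theorem mem_rootSpace_of_map_mem {S : E →L[ℂ] E} {x : E} (hx : S x ∈ rootSpace S) :
    x ∈ rootSpace S := by
  obtain ⟨n, hn⟩ := mem_rootSpace.1 hx
  exact mem_rootSpace.2 ⟨n + 1, by rwa [pow_succ, mul_apply_eq_comp]⟩

theorem finiteDimensional_ker_pow (S : E →L[ℂ] E) [FiniteDimensional ℂ S.ker] (n : ℕ) :
    FiniteDimensional ℂ (S ^ n).ker := by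
  rw [← Submodule.fg_iff_finiteDimensional]
  induction n with
  | zero =>
    have : (S ^ 0).ker = ⊥ := by rw [pow_zero]; exact LinearMap.ker_id
    rw [this]; exact Submodule.fg_bot
  | succ n ih =>
    have hS : S.ker.FG := (Submodule.fg_iff_finiteDimensional _).2 inferInstance
    refine Submodule.fg_of_fg_map_of_fg_inf_ker S.toLinearMap (ih.of_le ?_) (hS.of_le inf_le_right)
    rintro _ ⟨x, hx, rfl⟩
    have hx : (S ^ (n + 1)) x = 0 := hx
    rwa [pow_succ, mul_apply_eq_comp] at hx

theorem antitone_range_pow (S : E →L[ℂ] E) : Antitone fun n : ℕ => (S ^ n).range := by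
  refine antitone_nat_of_succ_le fun n => ?_
  rintro _ ⟨x, rfl⟩
  exact ⟨S x, by rw [pow_succ]; rfl⟩

theorem map_mem_range_pow {S R : E →L[ℂ] E} (h : Commute S R) (n : ℕ) {x : E}
    (hx : x ∈ (S ^ n).range) : R x ∈ (S ^ n).range := by
  obtain ⟨y, rfl⟩ := hx
  refine ⟨R y, ?_⟩
  change (S ^ n * R) y = (R * S ^ n) y
  rw [(h.pow_left n).eq]

/-- The traces of the iterated ranges on the finite-dimensional kernel form a decreasing chain of
subspaces, which must stabilize. -/
theorem exists_ker_inf_range_pow_le_iInf (S : E →L[ℂ] E) [FiniteDimensional ℂ S.ker] :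
    ∃ n : ℕ, S.ker ⊓ (S ^ n).range ≤ ⨅ m : ℕ, (S ^ m).range := by
  obtain ⟨n, hn⟩ := IsArtinian.monotone_stabilizes (R := ℂ) (M := S.ker)
    ⟨fun n => OrderDual.toDual ((S ^ n).range.comap S.ker.subtype), fun i j hij =>
      Submodule.comap_mono (antitone_range_pow S hij)⟩
  refine ⟨n, fun x hx => ?_⟩
  rw [Submodule.mem_iInf]
  intro m
  rcases le_total n m with h | h
  · have h1 : (S ^ n).range.comap S.ker.subtype = (S ^ m).range.comap S.ker.subtype := hn m h
    have h2 : (⟨x, hx.1⟩ : S.ker) ∈ (S ^ n).range.comap S.ker.subtype := hx.2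
    rw [h1] at h2
    exact h2
  · exact antitone_range_pow S h hx.2

/-- A bounded operator with finite-dimensional kernel maps the intersection of the ranges of its
powers onto itself. -/
theorem exists_preimage_mem_iInf_range_pow (S : E →L[ℂ] E) [FiniteDimensional ℂ S.ker] {y : E}
    (hy : y ∈ ⨅ m : ℕ, (S ^ m).range) : ∃ x ∈ ⨅ m : ℕ, (S ^ m).range, S x = y := by
  obtain ⟨n, hn⟩ := exists_ker_inf_range_pow_le_iInf S
  have hpre : ∀ m : ℕ, ∃ x ∈ (S ^ m).range, S x = y := fun m => by
    obtain ⟨z, hz⟩ := (Submodule.mem_iInf _).1 hy (m + 1)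
    exact ⟨(S ^ m) z, ⟨z, rfl⟩, by rw [← hz, pow_succ']; rfl⟩
  obtain ⟨x, hx, hxy⟩ := hpre n
  refine ⟨x, (Submodule.mem_iInf _).2 fun m => ?_, hxy⟩
  rcases le_total n m with h | h
  -- The preimages `x` and `x'` differ by an element of `ker S ∩ ran (S ^ n)`, already contained in
  -- every iterated range; so the fixed `x` works for all `m`.
  · obtain ⟨x', hx', hxy'⟩ := hpre m
    have h1 : x - x' ∈ S.ker ⊓ (S ^ n).range :=
      ⟨by simp [hxy, hxy'], sub_mem hx (antitone_range_pow S h hx')⟩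
    have h2 := (Submodule.mem_iInf _).1 (hn h1) m
    simpa using add_mem h2 hx'
  · exact antitone_range_pow S h hx

/-- A Fredholm operator that becomes injective under arbitrarily small perturbations along a
commuting operator has a finite-dimensional generalized null space. -/
theorem finiteDimensional_rootSpace [CompleteSpace E] (S R : E →L[ℂ] E) (hSR : Commute S R)
    [FiniteDimensional ℂ S.ker] (hS : S.range.CoFG)
    (hinj : ∃ᶠ ε in 𝓝 (0 : ℂ), Function.Injective ⇑(S - ε • R)) :
    FiniteDimensional ℂ (rootSpace S) := by
  set Y : Submodule ℂ E := ⨅ m : ℕ, (S ^ m).range with hY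
  have hYcl : IsClosed (Y : Set E) := by
    rw [hY, Submodule.coe_iInf]
    exact isClosed_iInter fun n => isClosed_range_of_cofg _ (cofg_range_pow S hS n)
  have : CompleteSpace Y := hYcl.completeSpace_coe
  have hmap : ∀ A : E →L[ℂ] E, Commute S A → ∀ x ∈ Y, A x ∈ Y := fun A hA x hx =>
    (Submodule.mem_iInf _).2 fun m => map_mem_range_pow hA m ((Submodule.mem_iInf _).1 hx m)
  let SY : Y →L[ℂ] Y := S.restrict (hmap S (Commute.refl S))
  let RY : Y →L[ℂ] Y := R.restrict (hmap R hSR)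
  have hker : FiniteDimensional ℂ SY.ker := by
    refine Module.Finite.of_injective
      ((Y.subtype.comp SY.ker.subtype).codRestrict S.ker fun x => ?_) ?_
    · exact congrArg Subtype.val x.2
    · intro x x' h
      have h' := congrArg Subtype.val h
      exact Subtype.ext (Subtype.ext h')
  have hsurj : Function.Surjective SY := fun y => by
    obtain ⟨x, hx, hxy⟩ := exists_preimage_mem_iInf_range_pow S y.2
    exact ⟨⟨x, hx⟩, Subtype.ext hxy⟩
  have hSY : Function.Injective SY := by
    refine injective_of_frequently_injective SY RY hsurj (hinj.mono fun ε h x x' hxx' => ?_)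
    exact Subtype.ext (h (congrArg Subtype.val hxx'))
  obtain ⟨n, hn⟩ := exists_ker_inf_range_pow_le_iInf S
  -- Here `S ^ n x` lies in `ker S ∩ ran (S ^ n)`, hence in `Y`, where `S` is injective: the kernels
  -- of powers stop growing at `n`.
  have hstep : ∀ x, (S ^ (n + 1)) x = 0 → (S ^ n) x = 0 := fun x hx => by
    have h1 : S ((S ^ n) x) = 0 := by rwa [pow_succ', mul_apply_eq_comp] at hx
    have h2 : (S ^ n) x ∈ Y := hn ⟨h1, ⟨x, rfl⟩⟩
    have h3 : (⟨(S ^ n) x, h2⟩ : Y) = 0 := hSY (by rw [map_zero]; exact Subtype.ext h1)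
    exact congrArg Subtype.val h3
  have hle : rootSpace S ≤ (S ^ n).ker := fun x hx => by
    obtain ⟨m, hm⟩ := mem_rootSpace.1 hx
    have key : ∀ (k : ℕ) (x : E), (S ^ (n + k)) x = 0 → (S ^ n) x = 0 := by
      intro k
      induction k with
      | zero => exact fun x hx => hx
      | succ k ih =>
        intro x hx
        refine hstep x ?_
        rw [pow_succ, mul_apply_eq_comp]
        exact ih _ (by rwa [← add_assoc, pow_succ, mul_apply_eq_comp] at hx)
    exact key m x (by rw [pow_add, mul_apply_eq_comp, hm, map_zero])
  have := finiteDimensional_ker_pow S n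
  exact Submodule.finiteDimensional_of_le hle

end RootSpace

/-! ### Passing to the quotient by the generalized null space -/

section Quotient

/-- If a linear endomorphism maps a finite-dimensional subspace `N` into itself and induces a
bijection on the quotient by `N`, then its kernel and cokernel are finite-dimensional of the same
dimension. -/
theorem finrank_ker_eq_finrank_quotient_range {K V : Type*} [Field K] [AddCommGroup V] [Module K V]
    (f : V →ₗ[K] V) (N : Submodule K V) [FiniteDimensional K N] (hN : ∀ x ∈ N, f x ∈ N)
    (hinj : ∀ x, f x ∈ N → x ∈ N) (hsurj : ∀ y, ∃ x, y - f x ∈ N) :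
    FiniteDimensional K (LinearMap.ker f) ∧ FiniteDimensional K (V ⧸ LinearMap.range f) ∧
      Module.finrank K (LinearMap.ker f) = Module.finrank K (V ⧸ LinearMap.range f) := by
  let g : N →ₗ[K] N := f.restrict hN
  have hkerN : LinearMap.ker f ≤ N := fun x hx => hinj x (by rw [LinearMap.mem_ker.1 hx]; simp)
  have hker : (LinearMap.ker g).map N.subtype = LinearMap.ker f := by
    ext x
    constructor
    · rintro ⟨y, hy, rfl⟩
      exact congrArg Subtype.val hy
    · intro hx
      exact ⟨⟨x, hkerN hx⟩, Subtype.ext hx, rfl⟩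
  -- Surjectivity modulo `N` makes `q` onto, and injectivity modulo `N` makes its kernel `ran g`. So
  -- `f` and `g` have isomorphic cokernels, and rank-nullity for `g` concludes.
  let q : N →ₗ[K] V ⧸ LinearMap.range f := (LinearMap.range f).mkQ.comp N.subtype
  have hq : Function.Surjective q := fun y => by
    obtain ⟨y, rfl⟩ := Submodule.mkQ_surjective _ y
    obtain ⟨x, hx⟩ := hsurj y
    refine ⟨⟨_, hx⟩, ?_⟩
    simp [q]
  have hqker : LinearMap.ker q = LinearMap.range g := by
    ext ⟨y, hy⟩
    simp only [q, LinearMap.mem_ker, LinearMap.comp_apply, Submodule.subtype_apply,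
      Submodule.mkQ_apply, Submodule.Quotient.mk_eq_zero, LinearMap.mem_range]
    constructor
    · rintro ⟨x, rfl⟩
      exact ⟨⟨x, hinj x hy⟩, rfl⟩
    · rintro ⟨x, hx⟩
      exact ⟨x, congrArg Subtype.val hx⟩
  have e : (N ⧸ LinearMap.range g) ≃ₗ[K] V ⧸ LinearMap.range f :=
    (Submodule.quotEquivOfEq _ _ hqker.symm).trans (q.quotKerEquivOfSurjective hq)
  refine ⟨Submodule.finiteDimensional_of_le hkerN, Module.Finite.of_surjective q hq, ?_⟩
  rw [← hker, Submodule.finrank_map_subtype_eq, ← e.finrank_eq]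
  have h1 := g.finrank_range_add_finrank_ker
  have h2 := (LinearMap.range g).finrank_quotient_add_finrank
  omega

variable {E : Type*} [NormedAddCommGroup E] [NormedSpace ℂ E]

/-- The bounded operator induced on the quotient by an invariant subspace. -/
def quotMap (N : Submodule ℂ E) (A : E →L[ℂ] E) (hA : ∀ x ∈ N, A x ∈ N) : E ⧸ N →L[ℂ] E ⧸ N :=
  N.liftQL (N.mkQL ∘L A) fun x hx => by simpa using hA x hx

theorem quotMap_mk (N : Submodule ℂ E) (A : E →L[ℂ] E) (hA : ∀ x ∈ N, A x ∈ N) (x : E) :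
    quotMap N A hA (N.mkQL x) = N.mkQL (A x) := rfl

/-- If `S` has closed range and a finite-dimensional generalized null space, and arbitrarily small
perturbations of `S` along a commuting operator are onto, then `S` is invertible modulo its
generalized null space. -/
theorem isUnit_quotMap_rootSpace [CompleteSpace E] (S R : E →L[ℂ] E) (hSR : Commute S R)
    (hcl : IsClosed (S.range : Set E)) [FiniteDimensional ℂ (rootSpace S)]
    (hsurj : ∃ᶠ ε in 𝓝 (0 : ℂ), Function.Surjective ⇑(S - ε • R)) :
    IsUnit (quotMap (rootSpace S) S fun _ => map_mem_rootSpace (Commute.refl S)) := by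
  set N := rootSpace S with hN
  have hNcl : IsClosed (N : Set E) := N.closed_of_finiteDimensional
  refine isUnit_of_frequently_surjective _ (quotMap N R fun _ => map_mem_rootSpace hSR) ?_ ?_
    (hsurj.mono fun ε h y => ?_)
  · rw [injective_iff_map_eq_zero]
    intro x hx
    obtain ⟨x, rfl⟩ := Submodule.mkQ_surjective _ x
    have hx : N.mkQL (S x) = 0 := hx
    rw [Submodule.mkQL_apply, Submodule.mkQ_apply, Submodule.Quotient.mk_eq_zero] at hx
    rw [Submodule.mkQ_apply, Submodule.Quotient.mk_eq_zero]
    exact mem_rootSpace_of_map_mem hx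
  -- The preimage in `E` of the induced range is `ran S + N`, closed because `N` is
  -- finite-dimensional.
  · rw [← N.isQuotientMap_mkQL.isClosed_preimage]
    convert Submodule.isClosed_sup_finiteDimensional S.range N hcl using 1
    ext y
    simp only [Set.mem_preimage, Set.mem_range, SetLike.mem_coe, Submodule.mem_sup]
    constructor
    · rintro ⟨x, hx⟩
      obtain ⟨x, rfl⟩ := Submodule.mkQ_surjective _ x
      have hx : N.mkQL (S x) = N.mkQL y := hx
      refine ⟨S x, ⟨x, rfl⟩, y - S x, ?_, by abel⟩
      rw [← Submodule.Quotient.mk_eq_zero, Submodule.Quotient.mk_sub, sub_eq_zero]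
      exact hx.symm
    · rintro ⟨_, ⟨x, rfl⟩, z, hz, rfl⟩
      refine ⟨N.mkQL x, ?_⟩
      rw [quotMap_mk, map_add]
      have : N.mkQL z = 0 := (Submodule.Quotient.mk_eq_zero N).2 hz
      rw [this, add_zero]; rfl
  · obtain ⟨y, rfl⟩ := Submodule.mkQ_surjective _ y
    obtain ⟨x, hx⟩ := h y
    exact ⟨N.mkQL x, by rw [← hx]; rfl⟩

end Quotient

/-! ### Reduction of the unbounded operator to a bounded one -/

section Resolvent

variable {X : Type*} [NormedAddCommGroup X] [NormedSpace ℂ X] {T : X →ₗ.[ℂ] X} {w : ℂ}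
  {R : X →L[ℂ] X}

theorem shift_eq (T : X →ₗ.[ℂ] X) (w z : ℂ) (d : T.domain) :
    shift T z d = shift T w d - (z - w) • (d : X) := by
  simp only [shift, LinearMap.sub_apply, LinearMap.smul_apply, Submodule.subtype_apply]
  module

theorem IsBoundedInverse.unique {R' : X →L[ℂ] X} (h : IsBoundedInverse T w R)
    (h' : IsBoundedInverse T w R') : R = R' := by
  ext x
  obtain ⟨hx, hxx⟩ := h'.1 x
  conv_lhs => rw [← hxx]
  exact h.2 _

theorem IsBoundedInverse.resolventOp_eq (h : IsBoundedInverse T w R) : resolventOp T w = R := by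
  have hex : ∃ R : X →L[ℂ] X, IsBoundedInverse T w R := ⟨R, h⟩
  rw [resolventOp, dif_pos hex]
  exact hex.choose_spec.unique h

/-- The operator `(T - z) (T - w)⁻¹ = 1 - (z - w) R`, where `R = (T - w)⁻¹`. -/
def shiftedInverse (R : X →L[ℂ] X) (w z : ℂ) : X →L[ℂ] X := 1 - (z - w) • R

theorem shiftedInverse_apply (R : X →L[ℂ] X) (w z : ℂ) (x : X) :
    shiftedInverse R w z x = x - (z - w) • R x := rfl

/-- This is why the perturbations above are taken along `R`: they amount to moving the spectral
parameter. -/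
theorem shiftedInverse_sub (R : X →L[ℂ] X) (w z ε : ℂ) :
    shiftedInverse R w z - ε • R = shiftedInverse R w (z + ε) := by
  simp only [shiftedInverse]
  module

theorem commute_shiftedInverse (R : X →L[ℂ] X) (w z : ℂ) : Commute (shiftedInverse R w z) R :=
  (Commute.one_left R).sub_left ((Commute.refl R).smul_left _)

theorem commute_shiftedInverse_shiftedInverse (R : X →L[ℂ] X) (w z z' : ℂ) :
    Commute (shiftedInverse R w z) (shiftedInverse R w z') :=
  (Commute.one_right _).sub_right ((commute_shiftedInverse R w z).smul_right _)

theorem IsBoundedInverse.shift_apply (h : IsBoundedInverse T w R) (z : ℂ) (x : X)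
    (hx : R x ∈ T.domain) : shift T z ⟨R x, hx⟩ = shiftedInverse R w z x := by
  rw [shift_eq T w z, (h.1 x).2]; rfl

theorem IsBoundedInverse.eq_apply (h : IsBoundedInverse T w R) (d : T.domain) :
    ∃ x, ∃ hx : R x ∈ T.domain, d = ⟨R x, hx⟩ :=
  ⟨shift T w d, (h.1 _).1, Subtype.ext (h.2 d).symm⟩

theorem IsBoundedInverse.mul_inverse (h : IsBoundedInverse T w R) {z : ℂ}
    (hz : IsUnit (shiftedInverse R w z)) :
    IsBoundedInverse T z (R * Ring.inverse (shiftedInverse R w z)) := by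
  refine ⟨fun x => ⟨(h.1 _).1, ?_⟩, fun d => ?_⟩
  · refine (h.shift_apply z _ (h.1 _).1).trans ?_
    change (shiftedInverse R w z * Ring.inverse (shiftedInverse R w z)) x = x
    rw [Ring.mul_inverse_cancel _ hz]; rfl
  · obtain ⟨x, hx, rfl⟩ := h.eq_apply d
    rw [h.shift_apply, mul_apply_eq_comp, ← mul_apply_eq_comp (Ring.inverse _),
      Ring.inverse_mul_cancel _ hz]; rfl

theorem IsBoundedInverse.isUnit_shiftedInverse [CompleteSpace X] (h : IsBoundedInverse T w R)
    {z : ℂ} (hz : z ∈ rho T) : IsUnit (shiftedInverse R w z) := by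
  obtain ⟨F, hF⟩ := hz
  rw [ContinuousLinearMap.isUnit_iff_bijective]
  constructor
  · rw [injective_iff_map_eq_zero]
    intro x hx
    have h1 : R x = 0 := by
      have := hF.2 ⟨R x, (h.1 x).1⟩
      rwa [h.shift_apply, hx, map_zero, eq_comm] at this
    rwa [shiftedInverse_apply, h1, smul_zero, sub_zero] at hx
  · intro x
    obtain ⟨hx, hxx⟩ := hF.1 x
    obtain ⟨y, hy, hxy⟩ := h.eq_apply ⟨F x, hx⟩
    exact ⟨y, by rw [← h.shift_apply z y hy, ← hxy, hxx]⟩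

theorem IsBoundedInverse.mem_rho_iff [CompleteSpace X] (h : IsBoundedInverse T w R) {z : ℂ} :
    z ∈ rho T ↔ IsUnit (shiftedInverse R w z) :=
  ⟨h.isUnit_shiftedInverse, fun hz => ⟨_, h.mul_inverse hz⟩⟩

theorem IsBoundedInverse.resolventOp_eq_mul_inverse [CompleteSpace X] (h : IsBoundedInverse T w R)
    {z : ℂ} (hz : z ∈ rho T) :
    resolventOp T z = R * Ring.inverse (shiftedInverse R w z) :=
  (h.mul_inverse (h.isUnit_shiftedInverse hz)).resolventOp_eq

theorem differentiable_shiftedInverse (R : X →L[ℂ] X) (w : ℂ) :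
    Differentiable ℂ (shiftedInverse R w) := by
  unfold shiftedInverse
  fun_prop

theorem isOpen_rho [CompleteSpace X] (T : X →ₗ.[ℂ] X) : IsOpen (rho T) := by
  rcases (rho T).eq_empty_or_nonempty with h | ⟨w, R, h⟩
  · rw [h]; exact isOpen_empty
  · have : rho T = shiftedInverse R w ⁻¹' {A | IsUnit A} := by
      ext z; exact h.mem_rho_iff
    rw [this]
    exact Units.isOpen.preimage (differentiable_shiftedInverse R w).continuous

theorem differentiableAt_mul_inverse_shiftedInverse [CompleteSpace X] {z : ℂ}
    (hz : IsUnit (shiftedInverse R w z)) :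
    DifferentiableAt ℂ (fun ζ => R * Ring.inverse (shiftedInverse R w ζ)) z :=
  ((differentiable_shiftedInverse R w z).inverse hz).const_mul R

theorem continuousOn_resolventOp [CompleteSpace X] (T : X →ₗ.[ℂ] X) :
    ContinuousOn (resolventOp T) (rho T) := by
  rintro z ⟨R, h⟩
  refine ContinuousWithinAt.congr
    (f := fun ζ => R * Ring.inverse (shiftedInverse R z ζ)) ?_ ?_ ?_
  · exact (differentiableAt_mul_inverse_shiftedInverse
      (h.isUnit_shiftedInverse ⟨R, h⟩)).continuousAt.continuousWithinAt
  · exact fun ζ hζ => h.resolventOp_eq_mul_inverse hζ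
  · exact h.resolventOp_eq_mul_inverse ⟨R, h⟩

theorem ran_eq_range (h : IsBoundedInverse T w R) (z : ℂ) :
    ran T z = (shiftedInverse R w z).range := by
  ext y
  constructor
  · rintro ⟨d, rfl⟩
    obtain ⟨x, hx, rfl⟩ := h.eq_apply d
    exact ⟨x, (h.shift_apply z x hx).symm⟩
  · rintro ⟨x, rfl⟩
    exact ⟨⟨R x, (h.1 x).1⟩, h.shift_apply z x _⟩

theorem exists_pow_one_sub_smul_eq (R : X →L[ℂ] X) (c : ℂ) (n : ℕ) :
    ∃ Q : X →L[ℂ] X, Commute (1 - c • R) Q ∧ (1 - c • R) ^ n = 1 - R * Q := by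
  have hR : Commute (1 - c • R) R := (Commute.one_left R).sub_left ((Commute.refl R).smul_left _)
  induction n with
  | zero => exact ⟨0, Commute.zero_right _, by simp⟩
  | succ n ih =>
    obtain ⟨Q, hQ, h⟩ := ih
    -- The witness comes from `(1 - c R)(1 - R Q) = 1 - R (c + (1 - c R) Q)`.
    refine ⟨c • 1 + (1 - c • R) * Q,
      ((Commute.one_right _).smul_right c).add_right ((Commute.refl _).mul_right hQ), ?_⟩
    rw [pow_succ', h, mul_sub, mul_one, mul_add, ← mul_assoc R, ← hR.eq, mul_assoc]
    rw [mul_smul_comm, mul_one]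
    abel

/-- Vectors annihilated by a power of `1 - c R` lie in the range of `R`. -/
theorem exists_eq_apply_of_pow_apply_eq_zero (R : X →L[ℂ] X) (c : ℂ) {n : ℕ} {x : X}
    (hx : ((1 - c • R) ^ n) x = 0) : ∃ y, R y = x ∧ ((1 - c • R) ^ n) y = 0 := by
  obtain ⟨Q, hQ, h⟩ := exists_pow_one_sub_smul_eq R c n
  refine ⟨Q x, ?_, ?_⟩
  · rw [h] at hx
    exact (sub_eq_zero.1 hx).symm
  · rw [← mul_apply_eq_comp, (hQ.pow_left n).eq, mul_apply_eq_comp, hx, map_zero]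

/-- One inclusion uses that `R` commutes with `S`. For the other, a vector killed by a power of `S`
must be shown to lie in `D(T)`: it is `R y` with `y` killed by the same power. -/
theorem kerPow_eq_ker_pow (h : IsBoundedInverse T w R) (z : ℂ) (n : ℕ) :
    kerPow T z n = (shiftedInverse R w z ^ n).ker := by
  induction n with
  | zero => rw [pow_zero]; exact LinearMap.ker_id.symm
  | succ n ih =>
    rw [kerPow, ih]
    ext x
    constructor
    · rintro ⟨d, hd, rfl⟩
      obtain ⟨y, hy, rfl⟩ := h.eq_apply d
      have hd : (shiftedInverse R w z ^ n) (shift T z ⟨R y, hy⟩) = 0 := hd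
      rw [h.shift_apply, ← mul_apply_eq_comp, ← pow_succ] at hd
      change (shiftedInverse R w z ^ (n + 1)) (R y) = 0
      rw [← mul_apply_eq_comp, ((commute_shiftedInverse R w z).pow_left _).eq, mul_apply_eq_comp,
        hd, map_zero]
    · intro hx
      obtain ⟨y, rfl, hy⟩ := exists_eq_apply_of_pow_apply_eq_zero R (z - w) (n := n + 1) hx
      refine ⟨⟨R y, (h.1 y).1⟩, ?_, rfl⟩
      change (shiftedInverse R w z ^ n) (shift T z ⟨R y, (h.1 y).1⟩) = 0
      rw [h.shift_apply, ← mul_apply_eq_comp, ← pow_succ]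
      exact hy

theorem genKer_eq_rootSpace (h : IsBoundedInverse T w R) (z : ℂ) :
    genKer T z = rootSpace (shiftedInverse R w z) := by
  apply le_antisymm
  · refine iSup_le fun n x hx => ?_
    rw [kerPow_eq_ker_pow h] at hx
    exact mem_rootSpace.2 ⟨n, hx⟩
  · intro x hx
    obtain ⟨n, hn⟩ := mem_rootSpace.1 hx
    refine le_iSup (kerPow T z) n ?_
    rw [kerPow_eq_ker_pow h]
    exact hn

theorem map_ker_shift (h : IsBoundedInverse T w R) (z : ℂ) :
    (LinearMap.ker (shift T z)).map T.domain.subtype = (shiftedInverse R w z).ker := by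
  have := kerPow_eq_ker_pow h z 1
  rwa [pow_one] at this

theorem finrank_ker_shift (h : IsBoundedInverse T w R) (z : ℂ) :
    Module.finrank ℂ (LinearMap.ker (shift T z)) =
      Module.finrank ℂ (shiftedInverse R w z).ker := by
  rw [← map_ker_shift h, Submodule.finrank_map_subtype_eq]

theorem finiteDimensional_ker_shift_iff (h : IsBoundedInverse T w R) (z : ℂ) :
    FiniteDimensional ℂ (LinearMap.ker (shift T z)) ↔
      FiniteDimensional ℂ (shiftedInverse R w z).ker := by
  rw [← map_ker_shift h]
  have e := Submodule.equivMapOfInjective _ T.domain.injective_subtype (LinearMap.ker (shift T z))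
  exact ⟨fun _ => e.finiteDimensional, fun _ => e.symm.finiteDimensional⟩

end Resolvent

/-! ### Contour integrals and the Riesz projection -/

theorem map_circleIntegral {E F : Type*} [NormedAddCommGroup E] [NormedSpace ℂ E] [CompleteSpace E]
    [NormedAddCommGroup F] [NormedSpace ℂ F] [CompleteSpace F] (L : E →L[ℂ] F) {f : ℂ → E} {c : ℂ}
    {r : ℝ} (hf : CircleIntegrable f c r) :
    L (∮ z in C(c, r), f z) = ∮ z in C(c, r), L (f z) := by
  simp only [circleIntegral, ← map_smul]
  exact (L.intervalIntegral_comp_comm hf.out).symm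

section RieszProjection

variable {X : Type*} [NormedAddCommGroup X] [NormedSpace ℂ X] {T : X →ₗ.[ℂ] X} {w z : ℂ}
  {R : X →L[ℂ] X} {r : ℝ}

theorem sphere_subset_rho (hr : 0 < r) (hz : Metric.closedBall z r \ {z} ⊆ rho T) :
    Metric.sphere z r ⊆ rho T := fun _ hζ =>
  hz ⟨Metric.sphere_subset_closedBall hζ, Metric.ne_of_mem_sphere hζ hr.ne'⟩

theorem commute_ringInverse_shiftedInverse (R : X →L[ℂ] X) (w z z' : ℂ) :
    Commute (shiftedInverse R w z) (Ring.inverse (shiftedInverse R w z')) := by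
  by_cases h : IsUnit (shiftedInverse R w z')
  · obtain ⟨u, hu⟩ := h
    rw [← hu, Ring.inverse_unit]
    exact Commute.units_inv_right (hu ▸ commute_shiftedInverse_shiftedInverse R w z z')
  · rw [Ring.inverse_non_unit _ h]
    exact Commute.zero_right _

variable [CompleteSpace X]

theorem circleIntegrable_resolventOp (hr : 0 < r) (hz : Metric.closedBall z r \ {z} ⊆ rho T) :
    CircleIntegrable (resolventOp T) z r :=
  ((continuousOn_resolventOp T).mono (sphere_subset_rho hr hz)).circleIntegrable hr.le

theorem circleIntegrable_inv_smul_resolventOp (hr : 0 < r)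
    (hz : Metric.closedBall z r \ {z} ⊆ rho T) :
    CircleIntegrable (fun ζ => (ζ - z)⁻¹ • resolventOp T ζ) z r := by
  refine ContinuousOn.circleIntegrable hr.le (ContinuousOn.fun_smul ?_
    ((continuousOn_resolventOp T).mono (sphere_subset_rho hr hz)))
  exact (continuousOn_id.sub continuousOn_const).inv₀ fun ζ hζ =>
    sub_ne_zero.2 (Metric.ne_of_mem_sphere hζ hr.ne')

theorem commute_shiftedInverse_resolventOp (h : IsBoundedInverse T w R) (z : ℂ) {ζ : ℂ}
    (hζ : ζ ∈ rho T) : Commute (shiftedInverse R w z) (resolventOp T ζ) := by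
  rw [h.resolventOp_eq_mul_inverse hζ]
  exact (commute_shiftedInverse R w z).mul_right (commute_ringInverse_shiftedInverse R w z ζ)

theorem commute_circleIntegral {A : X →L[ℂ] X} {f : ℂ → X →L[ℂ] X} (hr : 0 ≤ r)
    (hf : CircleIntegrable f z r) (hA : ∀ ζ ∈ Metric.sphere z r, Commute A (f ζ)) :
    Commute A (∮ ζ in C(z, r), f ζ) := by
  have h1 := map_circleIntegral (ContinuousLinearMap.mul ℂ (X →L[ℂ] X) A) hf
  have h2 := map_circleIntegral ((ContinuousLinearMap.mul ℂ (X →L[ℂ] X)).flip A) hf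
  simp only [ContinuousLinearMap.mul_apply', ContinuousLinearMap.flip_apply] at h1 h2
  rw [commute_iff_eq, h1, h2]
  exact circleIntegral.integral_congr hr fun ζ hζ => (hA ζ hζ).eq

/-- If `S = (T - z) (T - w)⁻¹` is invertible modulo its finite-dimensional generalized null space,
then that space contains the range of the Riesz projection. -/
theorem range_rieszProjection_le (h : IsBoundedInverse T w R) (hr : 0 < r)
    (hz : Metric.closedBall z r \ {z} ⊆ rho T)
    [FiniteDimensional ℂ (rootSpace (shiftedInverse R w z))]
    (hu : IsUnit (quotMap (rootSpace (shiftedInverse R w z)) (shiftedInverse R w z)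
      fun _ => map_mem_rootSpace (Commute.refl _))) :
    (rieszProjection T z r).range ≤ rootSpace (shiftedInverse R w z) := by
  set S := shiftedInverse R w z with hS
  set N := rootSpace S with hN
  have hNcl : IsClosed (N : Set X) := N.closed_of_finiteDimensional
  let R' : X ⧸ N →L[ℂ] X ⧸ N := quotMap N R fun _ => map_mem_rootSpace (commute_shiftedInverse R w z)
  have hshift : ∀ ζ x, shiftedInverse R' w ζ (N.mkQL x) = N.mkQL (shiftedInverse R w ζ x) :=
    fun ζ x => rfl
  have hunit : ∀ ζ ∈ Metric.closedBall z r, IsUnit (shiftedInverse R' w ζ) := by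
    intro ζ hζ
    by_cases hζz : ζ = z
    · subst hζz
      convert hu using 1
      ext x
      obtain ⟨x, rfl⟩ := Submodule.mkQ_surjective _ x
      rfl
    -- Away from `z` the inverse descends to the quotient, since it commutes with `S` and so
    -- preserves `N`.
    · have hunit := h.isUnit_shiftedInverse (hz ⟨hζ, hζz⟩)
      have hcomm := commute_ringInverse_shiftedInverse R w z ζ
      refine isUnit_iff_exists.2 ⟨quotMap N (Ring.inverse (shiftedInverse R w ζ))
        fun _ => map_mem_rootSpace hcomm, ?_, ?_⟩
      · ext x
        obtain ⟨x, rfl⟩ := Submodule.mkQ_surjective _ x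
        change N.mkQL ((shiftedInverse R w ζ * Ring.inverse (shiftedInverse R w ζ)) x) = N.mkQL x
        rw [Ring.mul_inverse_cancel _ hunit]; rfl
      · ext x
        obtain ⟨x, rfl⟩ := Submodule.mkQ_surjective _ x
        change N.mkQL ((Ring.inverse (shiftedInverse R w ζ) * shiftedInverse R w ζ) x) = N.mkQL x
        rw [Ring.inverse_mul_cancel _ hunit]; rfl
  have hdiff : ∀ ζ ∈ Metric.closedBall z r, ∀ x, DifferentiableAt ℂ
      (fun ζ => (R' * Ring.inverse (shiftedInverse R' w ζ)) x) ζ := fun ζ hζ x =>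
    (differentiableAt_mul_inverse_shiftedInverse (hunit ζ hζ)).clm_apply
      (differentiableAt_const x)
  rintro _ ⟨x, rfl⟩
  -- Modulo `N` the integrand agrees on the circle with the resolvent formula built from `R'`, which
  -- is holomorphic on the whole disc including `z`; Cauchy's theorem applies.
  have hint : N.mkQL ((∮ ζ in C(z, r), resolventOp T ζ) x) = 0 := by
    have h1 := map_circleIntegral (N.mkQL ∘L ContinuousLinearMap.apply ℂ X x)
      (circleIntegrable_resolventOp hr hz)
    simp only [ContinuousLinearMap.comp_apply, ContinuousLinearMap.apply_apply] at h1
    rw [h1, circleIntegral.integral_congr hr.le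
      (g := fun ζ => (R' * Ring.inverse (shiftedInverse R' w ζ)) (N.mkQL x))]
    · exact Complex.circleIntegral_eq_zero_of_differentiable_on_off_countable hr.le
        Set.countable_empty (fun ζ hζ => (hdiff ζ hζ _).continuousAt.continuousWithinAt)
        fun ζ hζ => hdiff ζ (Metric.ball_subset_closedBall hζ.1) _
    · intro ζ hζ
      have hζ' := sphere_subset_rho hr hz hζ
      have hv := h.isUnit_shiftedInverse hζ'
      have hv' := hunit ζ (Metric.sphere_subset_closedBall hζ)
      simp only
      rw [h.resolventOp_eq_mul_inverse hζ']
      obtain ⟨y, rfl⟩ := ((ContinuousLinearMap.isUnit_iff_bijective).1 hv).2 x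
      rw [← hshift, ← mul_apply_eq_comp, mul_assoc, Ring.inverse_mul_cancel _ hv,
        ← mul_apply_eq_comp (_ * _), mul_assoc, Ring.inverse_mul_cancel _ hv']
      rfl
  have : (rieszProjection T z r) x =
      -((2 * Real.pi * Complex.I : ℂ)⁻¹ • (∮ ζ in C(z, r), resolventOp T ζ) x) := rfl
  change (rieszProjection T z r) x ∈ N
  rw [this]
  exact N.neg_mem (N.smul_mem _ ((Submodule.Quotient.mk_eq_zero N).1 hint))

/-- `S = (T - z) (T - w)⁻¹` is invertible up to the Riesz projection. -/
theorem exists_mul_eq_one_sub_rieszProjection (h : IsBoundedInverse T w R) (hr : 0 < r)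
    (hz : Metric.closedBall z r \ {z} ⊆ rho T) :
    ∃ L : X →L[ℂ] X, shiftedInverse R w z * L = 1 - rieszProjection T z r ∧
      L * shiftedInverse R w z = 1 - rieszProjection T z r := by
  set S := shiftedInverse R w z with hS
  set P := rieszProjection T z r with hP
  set c : ℂ := (2 * Real.pi * Complex.I : ℂ)⁻¹ with hc
  have hc0 : (2 * Real.pi * Complex.I : ℂ) ≠ 0 := Complex.two_pi_I_ne_zero
  set I₀ := ∮ ζ in C(z, r), resolventOp T ζ with hI₀
  set I₁ := ∮ ζ in C(z, r), (ζ - z)⁻¹ • resolventOp T ζ with hI₁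
  have hf := circleIntegrable_resolventOp hr hz
  have hf' := circleIntegrable_inv_smul_resolventOp hr hz
  have hcomm : ∀ ζ ∈ Metric.sphere z r, Commute S (resolventOp T ζ) := fun ζ hζ =>
    commute_shiftedInverse_resolventOp h z (sphere_subset_rho hr hz hζ)
  have hS₀ : Commute S I₀ := commute_circleIntegral hr.le hf hcomm
  have hS₁ : Commute S I₁ :=
    commute_circleIntegral hr.le hf' fun ζ hζ => (hcomm ζ hζ).smul_right _
  have hPI : P = -(c • I₀) := rfl
  -- Up to `2πi`, `I₁` is the constant Laurent coefficient of the resolvent at `z`. The identity is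
  -- `S (T - ζ)⁻¹ = R + (ζ - z) R (T - ζ)⁻¹`, divided by `ζ - z` and integrated.
  have hSI : S * I₁ = (2 * Real.pi * Complex.I : ℂ) • R + R * I₀ := by
    have h1 := map_circleIntegral (ContinuousLinearMap.mul ℂ (X →L[ℂ] X) S) hf'
    have h2 := map_circleIntegral (ContinuousLinearMap.mul ℂ (X →L[ℂ] X) R) hf
    simp only [ContinuousLinearMap.mul_apply'] at h1 h2
    have h3 : (∮ ζ in C(z, r), (ζ - z)⁻¹ • R) = (2 * Real.pi * Complex.I : ℂ) • R := by
      rw [circleIntegral.integral_smul_const, circleIntegral.integral_sub_center_inv z hr.ne']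
    rw [hI₁, hI₀, h1, h2, ← h3, ← circleIntegral.integral_add]
    · refine circleIntegral.integral_congr hr.le fun ζ hζ => ?_
      have hζ' := sphere_subset_rho hr hz hζ
      have hne : ζ - z ≠ 0 := sub_ne_zero.2 (Metric.ne_of_mem_sphere hζ hr.ne')
      have hres : resolventOp T ζ - (ζ - w) • (R * resolventOp T ζ) = R := by
        have hv := h.isUnit_shiftedInverse hζ'
        have h4 : shiftedInverse R w ζ * resolventOp T ζ = R := by
          rw [h.resolventOp_eq_mul_inverse hζ', ← mul_assoc, (commute_shiftedInverse R w ζ).eq,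
            mul_assoc, Ring.mul_inverse_cancel _ hv, mul_one]
        rwa [shiftedInverse, sub_mul, one_mul, smul_mul_assoc] at h4
      have hSF : S * resolventOp T ζ = R + (ζ - z) • (R * resolventOp T ζ) := by
        rw [hS, shiftedInverse, sub_mul, one_mul, smul_mul_assoc]
        calc resolventOp T ζ - (z - w) • (R * resolventOp T ζ)
            = resolventOp T ζ - (ζ - w) • (R * resolventOp T ζ)
              + (ζ - z) • (R * resolventOp T ζ) := by module
          _ = _ := by rw [hres]
      simp only [mul_smul_comm]
      rw [hSF, smul_add, smul_smul, inv_mul_cancel₀ hne, one_smul]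
    · exact ((continuousOn_id.sub continuousOn_const).inv₀ fun ζ hζ =>
        sub_ne_zero.2 (Metric.ne_of_mem_sphere hζ hr.ne')).smul continuousOn_const
          |>.circleIntegrable hr.le
    · exact ((continuousOn_const (c := R)).mul ((continuousOn_resolventOp T).mono
        (sphere_subset_rho hr hz))).circleIntegrable hr.le
  have hSB : S * (c • I₁) = R - R * P := by
    rw [mul_smul_comm, hSI, smul_add, smul_smul, hc, inv_mul_cancel₀ hc0, one_smul, hPI, mul_neg,
      mul_smul_comm, sub_neg_eq_add]
  -- As `S (1 - P) = (1 - P) - (z - w) R (1 - P)`, the term `(z - w) c I₁` cancels the error because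
  -- `S (c I₁) = R (1 - P)`.
  have hSL : S * (1 - P + (z - w) • c • I₁) = 1 - P := by
    have h1 : S * (1 - P) = 1 - P - (z - w) • (R - R * P) := by
      rw [hS, shiftedInverse, sub_mul, smul_mul_assoc, one_mul, mul_sub, mul_one]
    rw [mul_add, mul_smul_comm, hSB, h1, sub_add_cancel]
  refine ⟨1 - P + (z - w) • c • I₁, hSL, ?_⟩
  refine Eq.trans (Commute.eq (Commute.symm ?_)) hSL
  refine ((Commute.one_right S).sub_right ?_).add_right ((hS₁.smul_right _).smul_right _)
  rw [hPI]
  exact (hS₀.smul_right _).neg_right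

end RieszProjection

/-! ### Comparison of the spectra -/

section EssentialSpectrum

variable {X : Type*} [NormedAddCommGroup X] [NormedSpace ℂ X] {T : X →ₗ.[ℂ] X} {z : ℂ}

theorem not_accPt_sigma_iff : ¬ AccPt z (𝓟 (sigma T)) ↔ ∀ᶠ w in 𝓝[≠] z, w ∈ rho T := by
  rw [accPt_iff_frequently_nhdsNE, not_frequently]
  simp only [sigma, Set.mem_compl_iff, not_not]

theorem exists_closedBall_diff_subset_rho (h : ∀ᶠ w in 𝓝[≠] z, w ∈ rho T) :
    ∃ r : ℝ, 0 < r ∧ Metric.closedBall z r \ {z} ⊆ rho T := by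
  rw [eventually_nhdsWithin_iff] at h
  obtain ⟨r, hr, hball⟩ := Metric.nhds_basis_closedBall.eventually_iff.1 h
  exact ⟨r, hr, fun w hw => hball hw.1 hw.2⟩

theorem HasFiniteAlgMult.eventually_mem_rho (h : HasFiniteAlgMult T z) :
    ∀ᶠ w in 𝓝[≠] z, w ∈ rho T := by
  obtain ⟨r, hr, hball, -⟩ := h
  rw [eventually_nhdsWithin_iff]
  filter_upwards [Metric.closedBall_mem_nhds z hr] with w hw hwz
  exact hball ⟨hw, hwz⟩

variable [CompleteSpace X]

theorem exists_isBoundedInverse_frequently_bijective (h : ∀ᶠ w in 𝓝[≠] z, w ∈ rho T) :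
    ∃ (w : ℂ) (R : X →L[ℂ] X), IsBoundedInverse T w R ∧
      ∃ᶠ ε in 𝓝 (0 : ℂ), Function.Bijective ⇑(shiftedInverse R w z - ε • R) := by
  obtain ⟨w, R, hR⟩ := h.exists
  refine ⟨w, R, hR, ?_⟩
  have ht : Tendsto (fun ε : ℂ => z + ε) (𝓝[≠] 0) (𝓝[≠] z) := by
    refine tendsto_nhdsWithin_iff.2 ⟨?_, ?_⟩
    · have : Continuous fun ε : ℂ => z + ε := by fun_prop
      have h0 : Tendsto (fun ε : ℂ => z + ε) (𝓝 0) (𝓝 z) := by simpa using this.tendsto 0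
      exact h0.mono_left nhdsWithin_le_nhds
    · filter_upwards [self_mem_nhdsWithin] with ε hε
      simpa using hε
  refine ((ht.eventually h).mono fun ε hε => ?_).frequently.filter_mono nhdsWithin_le_nhds
  rw [shiftedInverse_sub, ← ContinuousLinearMap.isUnit_iff_bijective]
  exact hR.isUnit_shiftedInverse hε

/-- At a point that is not a limit point of the spectrum, Fredholmness makes the generalized null
space finite-dimensional. -/
theorem finiteDimensional_genKer_of_isFredholmAt (h : ∀ᶠ w in 𝓝[≠] z, w ∈ rho T)
    (hF : IsFredholmAt T z) : FiniteDimensional ℂ (genKer T z) := by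
  obtain ⟨w, R, hR, hfreq⟩ := exists_isBoundedInverse_frequently_bijective h
  obtain ⟨-, hker, hran⟩ := hF
  rw [finiteDimensional_ker_shift_iff hR] at hker
  rw [ran_eq_range hR] at hran
  rw [genKer_eq_rootSpace hR]
  exact finiteDimensional_rootSpace _ R (commute_shiftedInverse R w z) hran
    (hfreq.mono fun _ hε => hε.1)

/-- At a point that is not a limit point of the spectrum, if `T - z` has closed range and a
finite-dimensional generalized null space, then it is Fredholm of index zero and `z` has finite
algebraic multiplicity. -/
theorem isFredholmAt_of_finiteDimensional_genKer (h : ∀ᶠ w in 𝓝[≠] z, w ∈ rho T)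
    (hcl : IsClosed (ran T z : Set X)) (hgen : FiniteDimensional ℂ (genKer T z)) :
    IsFredholmAt T z ∧ indexAt T z = 0 ∧ HasFiniteAlgMult T z := by
  obtain ⟨w, R, hR, hfreq⟩ := exists_isBoundedInverse_frequently_bijective h
  have hcl' := hcl
  rw [ran_eq_range hR] at hcl'
  rw [genKer_eq_rootSpace hR] at hgen
  have hunit := isUnit_quotMap_rootSpace _ R (commute_shiftedInverse R w z) hcl'
    (hfreq.mono fun _ hε => hε.2)
  set S := shiftedInverse R w z with hS
  have hNcl : IsClosed (rootSpace S : Set X) := (rootSpace S).closed_of_finiteDimensional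
  obtain ⟨hker, hran, hdim⟩ := finrank_ker_eq_finrank_quotient_range S.toLinearMap (rootSpace S)
    (fun x hx => map_mem_rootSpace (Commute.refl S) hx) (fun x hx => mem_rootSpace_of_map_mem hx)
    (fun y => by
      obtain ⟨x, hx⟩ := (ContinuousLinearMap.isUnit_iff_bijective.1 hunit).2 ((rootSpace S).mkQL y)
      obtain ⟨x, rfl⟩ := Submodule.mkQ_surjective _ x
      refine ⟨x, ?_⟩
      rw [← Submodule.Quotient.mk_eq_zero, Submodule.Quotient.mk_sub, sub_eq_zero]
      exact hx.symm)
  refine ⟨⟨hcl, (finiteDimensional_ker_shift_iff hR z).2 hker, ?_⟩, ?_, ?_⟩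
  · rw [ran_eq_range hR]; exact hran
  · rw [indexAt, finrank_ker_shift hR, ran_eq_range hR, ← hS, hdim, sub_self]
  · obtain ⟨r, hr, hball⟩ := exists_closedBall_diff_subset_rho h
    exact ⟨r, hr, hball,
      Submodule.finiteDimensional_of_le (range_rieszProjection_le hR hr hball hunit)⟩

/-- A point of finite algebraic multiplicity has a finite-dimensional generalized null space, and
`T - z` has closed range there. -/
theorem HasFiniteAlgMult.isClosed_ran_and_finiteDimensional_genKer (h : HasFiniteAlgMult T z) :
    IsClosed (ran T z : Set X) ∧ FiniteDimensional ℂ (genKer T z) := by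
  obtain ⟨w, R, hR⟩ := h.eventually_mem_rho.exists
  obtain ⟨r, hr, hball, hfin⟩ := h
  obtain ⟨L, hSL, hLS⟩ := exists_mul_eq_one_sub_rieszProjection hR hr hball
  rw [ran_eq_range hR, genKer_eq_rootSpace hR]
  set S := shiftedInverse R w z
  set P := rieszProjection T z r
  constructor
  · refine isClosed_range_of_cofg S (Module.Finite.of_surjective
      (S.range.mkQ.comp P.range.subtype) fun y => ?_)
    obtain ⟨y, rfl⟩ := Submodule.mkQ_surjective _ y
    refine ⟨⟨P y, ⟨y, rfl⟩⟩, ?_⟩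
    have hy : y - P y = S (L y) := (congrArg (fun A : X →L[ℂ] X => A y) hSL).symm
    change S.range.mkQ (P y) = S.range.mkQ y
    rw [eq_comm, ← sub_eq_zero, ← map_sub, hy, Submodule.mkQ_apply,
      Submodule.Quotient.mk_eq_zero]
    exact ⟨L y, rfl⟩
  · refine Submodule.finiteDimensional_of_le (S₂ := P.range) fun x hx => ?_
    obtain ⟨n, hn⟩ := mem_rootSpace.1 hx
    have hcomm : Commute L S := hLS.trans hSL.symm
    -- By commutation `(1 - P) ^ n = L ^ n S ^ n` kills `x`; expanding the power then exhibits `x`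
    -- as a value of `P`.
    have hpow : ((1 - (1 : ℂ) • P) ^ n) x = 0 := by
      rw [one_smul, ← hLS, hcomm.mul_pow, mul_apply_eq_comp, hn, map_zero]
    obtain ⟨y, hy, -⟩ := exists_eq_apply_of_pow_apply_eq_zero P 1 hpow
    exact ⟨y, hy⟩

/-- Both directions go through finite dimensionality of the generalized null space together with
closed range. -/
theorem hasFiniteAlgMult_iff (h : ∀ᶠ w in 𝓝[≠] z, w ∈ rho T) :
    HasFiniteAlgMult T z ↔ IsFredholmAt T z ∧ indexAt T z = 0 := by
  constructor
  · intro hz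
    obtain ⟨hcl, hgen⟩ := hz.isClosed_ran_and_finiteDimensional_genKer
    obtain ⟨h1, h2, -⟩ := isFredholmAt_of_finiteDimensional_genKer h hcl hgen
    exact ⟨h1, h2⟩
  · rintro ⟨hF, -⟩
    exact (isFredholmAt_of_finiteDimensional_genKer h hF.1
      (finiteDimensional_genKer_of_isFredholmAt h hF)).2.2

theorem Delta5_eq_DeltaB (T : X →ₗ.[ℂ] X) : Delta5 T = DeltaB T := by
  ext z
  constructor
  · rintro ⟨hF, hind, h⟩
    exact ⟨hF.1, (hasFiniteAlgMult_iff h).2 ⟨hF, hind⟩, not_accPt_sigma_iff.2 h⟩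
  · rintro ⟨-, hz, hacc⟩
    have h := not_accPt_sigma_iff.1 hacc
    obtain ⟨hF, hind⟩ := (hasFiniteAlgMult_iff h).1 hz
    exact ⟨hF, hind, h⟩

theorem Delta5_eq_DeltaB' (T : X →ₗ.[ℂ] X) : Delta5 T = DeltaB' T := by
  ext z
  constructor
  · rintro ⟨hF, -, h⟩
    exact ⟨hF.1, finiteDimensional_genKer_of_isFredholmAt h hF, not_accPt_sigma_iff.2 h⟩
  · rintro ⟨hcl, hgen, hacc⟩
    have h := not_accPt_sigma_iff.1 hacc
    obtain ⟨hF, hind, -⟩ := isFredholmAt_of_finiteDimensional_genKer h hcl hgen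
    exact ⟨hF, hind, h⟩

theorem rho_subset_Delta5 (T : X →ₗ.[ℂ] X) : rho T ⊆ Delta5 T := by
  intro z hz
  have h : ∀ᶠ w in 𝓝[≠] z, w ∈ rho T :=
    nhdsWithin_le_nhds ((isOpen_rho T).mem_nhds hz)
  obtain ⟨R, hR⟩ := hz
  -- At a resolvent point one may take `w = z`, and then `S = 1`.
  have hS : shiftedInverse R z z = 1 := by simp [shiftedInverse]
  have hran : ran T z = ⊤ := by rw [ran_eq_range hR, hS]; exact LinearMap.range_id
  have hgen : genKer T z = ⊥ := by
    rw [genKer_eq_rootSpace hR, hS, eq_bot_iff]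
    intro x hx
    obtain ⟨n, hn⟩ := mem_rootSpace.1 hx
    rwa [one_pow] at hn
  obtain ⟨hF, hind, -⟩ := isFredholmAt_of_finiteDimensional_genKer h
    (by rw [hran]; exact isClosed_univ) (by rw [hgen]; infer_instance)
  exact ⟨hF, hind, h⟩

theorem sigmaDisc_eq (T : X →ₗ.[ℂ] X) :
    sigmaDisc T = {z | z ∈ isolatedSpectrum T ∧ IsFredholmAt T z ∧ indexAt T z = 0} := by
  ext z
  exact and_congr_right fun hz => hasFiniteAlgMult_iff (not_accPt_sigma_iff.1 hz.2)

theorem sigmaEss5_eq (T : X →ₗ.[ℂ] X) : sigmaEss5 T = sigma T \ sigmaDisc T := by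
  rw [sigmaDisc_eq]
  ext z
  constructor
  · intro hz
    refine ⟨fun h => hz (rho_subset_Delta5 T h), ?_⟩
    rintro ⟨⟨-, hacc⟩, hF, hind⟩
    exact hz ⟨hF, hind, not_accPt_sigma_iff.1 hacc⟩
  · rintro ⟨hz, hdisc⟩ ⟨hF, hind, h⟩
    exact hdisc ⟨⟨hz, not_accPt_sigma_iff.2 h⟩, hF, hind⟩

end EssentialSpectrum

end ClosedOperator

/-- Closedness of `T` is not used in the proof: it is automatic when the resolvent set is nonempty,
and otherwise every point of the plane is a limit point of the spectrum. -/
theorem mainTheorem3 {X : Type*} [NormedAddCommGroup X] [NormedSpace ℂ X] [CompleteSpace X]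
    (T : X →ₗ.[ℂ] X) (hT : T.IsClosed) :
    ClosedOperator.sigmaDisc T =
        {z | z ∈ ClosedOperator.isolatedSpectrum T ∧ ClosedOperator.IsFredholmAt T z ∧
          ClosedOperator.indexAt T z = 0} ∧
      ClosedOperator.sigmaEss5 T = ClosedOperator.sigma T \ ClosedOperator.sigmaDisc T ∧
      ClosedOperator.sigmaEssB T = ClosedOperator.sigmaEss5 T ∧
      ClosedOperator.sigmaEssB' T = ClosedOperator.sigmaEss5 T := by
  refine ⟨ClosedOperator.sigmaDisc_eq T, ClosedOperator.sigmaEss5_eq T, ?_, ?_⟩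
  · rw [ClosedOperator.sigmaEssB, ClosedOperator.sigmaEss5, ClosedOperator.Delta5_eq_DeltaB]
  · rw [ClosedOperator.sigmaEssB', ClosedOperator.sigmaEss5, ClosedOperator.Delta5_eq_DeltaB']
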